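/- Let $\mathcal C$ be a small non-empty category satisfying the amalgamation property (every pair of arrows $f:a\to b$, $g:a\to c$ can be completed to a commutative square $f'\circ f=g'\circ g$) and the joint embedding property (any two objects of $\mathcal C$ admit arrows to a common object). Let $u$ be an object of the ind-completion $\mathrm{Ind}(\mathcal C)$ which is $\mathcal C$-universal (every object of $\mathcal C$ admits an arrow to $u$ in $\mathrm{Ind}(\mathcal C)$) and $\mathcal C$-ultrahomogeneous (for all arrows $j:a\to b$ in $\mathcal C$ and $\chi_1:a\to u$, $\chi_2:b\to u$ in $\mathrm{Ind}(\mathcal C)$ there is an automorphism $e$ of $u$ with $e\circ\chi_1=\chi_2\circ j$). Let $\mathrm{Aut}_{\mathcal C}(u)$ be the group of automorphisms of $u$ in $\mathrm{Ind}(\mathcal C)$, endowed with the group topology in which the subgroups $\mathcal I_\chi=\{z:u\cong u\mid z\circ\chi=\chi\}$, for $\chi:c\to u$ with $c$ an object of $\mathcal C$, form a base of neighbourhoods of the identity. An equivalence relation $R$ on $\mathcal C(c,-)$ in $[\mathcal C,\mathbf{Set}]$ consists of an equivalence relation $R_e$ on $\mathcal C(c,e)$ for every object $e$ of $\mathcal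 C$, such that $(f,g)\in R_e$ implies $(h\circ f,h\circ g)\in R_{e'}$ for every $h:e\to e'$; $(f,g)\in R$ means $(f,g)\in R_e$ for the common codomain $e$ of $f$ and $g$. For $\xi:c\to u$ and such an $R$, put $$U_{\xi,R}=\{z\in \mathrm{Aut}_{\mathcal C}(u)\mid \xi=\chi\circ f \text{ and } z\circ\xi=\chi\circ g \text{ for some } (f,g)\in R \text{ and } \chi:\mathrm{cod}(f)\to u\}.$$ Then a subset $U$ of $\mathrm{Aut}_{\mathcal C}(u)$ is an open subgroup if and only if there exist an object $c$ of $\mathcal C$, an arrow $\xi:c\to u$ and an equivalence relation $R$ on $\mathcal C(c,-)$ in $[\mathcal C,\mathbf{Set}]$ such that $U=U_{\xi,R}$. More precisely, for any object $c$ of $\mathcal C$ and any $\xi:c\to u$, a subset $U$ of $\mathrm{Aut}_{\mathcal C}(u)$ with $\mathcal I_\xi\subseteq U$ is an open subgroup of $\mathrm{Aut}_{\mathcal C}(u)$ if and only if there exists an equivalence relation $R$ on $\mathcal C(c,-)$ in $[\mathcal C,\mathbf{Set}]$ such that $U=U_{\xi,R}$. -/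

import Mathlib

universe v w₁ w₂

open CategoryTheory Opposite

namespace IndGalois

/-- The amalgamation property: every span `b ← a → c` can be completed to a commutative square. -/
def AmalgamationProperty (C : Type w₁) [Category.{v} C] : Prop :=
  ∀ ⦃a b c : C⦄ (f : a ⟶ b) (g : a ⟶ c),
    ∃ (d : C) (f' : b ⟶ d) (g' : c ⟶ d), f ≫ f' = g ≫ g'

/-- The joint embedding property: any two objects map to a common object. -/
def JointEmbeddingProperty (C : Type w₁) [Category.{v} C] : Prop :=
  ∀ a b : C, ∃ c : C, Nonempty (a ⟶ c) ∧ Nonempty (b ⟶ c)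

/-- An object `u` of the codomain of an embedding `E : C ⥤ D` is `C`-universal if every object
of `C` admits an arrow to it. -/
def IsUniversal {C : Type w₁} [Category.{v} C] {D : Type w₂} [Category.{v} D]
    (E : C ⥤ D) (u : D) : Prop :=
  ∀ a : C, Nonempty (E.obj a ⟶ u)

/-- An object `u` of the codomain of an embedding `E : C ⥤ D` is `C`-ultrahomogeneous if for every
`j : a ⟶ b` in `C`, `χ₁ : a ⟶ u` and `χ₂ : b ⟶ u` there is an automorphism `e` of `u` with
`e ∘ χ₁ = χ₂ ∘ j`. -/
def IsUltrahomogeneous {C : Type w₁} [Category.{v} C] {D : Type w₂} [Category.{v} D]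
    (E : C ⥤ D) (u : D) : Prop :=
  ∀ ⦃a b : C⦄ (j : a ⟶ b) (χ₁ : E.obj a ⟶ u) (χ₂ : E.obj b ⟶ u),
    ∃ e : u ≅ u, χ₁ ≫ e.hom = E.map j ≫ χ₂

/-- The subgroup `I_χ` of the automorphisms `z` of `u` such that `z ∘ χ = χ`. -/
def stab {D : Type w₂} [Category.{v} D] {x u : D} (χ : x ⟶ u) : Subgroup (Aut u) where
  carrier := {z | χ ≫ z.hom = χ}
  one_mem' := Category.comp_id χ
  mul_mem' := by
    intro a b ha hb
    change χ ≫ b.hom ≫ a.hom = χ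
    rw [← Category.assoc, (hb : χ ≫ b.hom = χ), (ha : χ ≫ a.hom = χ)]
  inv_mem' := by
    intro a ha
    let i : u ≅ u := a
    exact (Iso.comp_inv_eq i).2 (show χ ≫ i.hom = χ from ha).symm

/-- An equivalence relation on an object `F` of the functor category `[C, Set]`: an equivalence
relation on every `F(e)`, preserved by the maps `F(h)`, i.e. forming a subfunctor of `F × F`. -/
structure FunctorEquivRel {C : Type w₁} [Category.{v} C] (F : C ⥤ Type v) where
  /-- the equivalence relation on `F(e)` -/
  rel : ∀ e : C, Setoid (F.obj e)
  /-- stability under the action of arrows -/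
  map_rel : ∀ ⦃e e' : C⦄ (h : e ⟶ e') ⦃x y : F.obj e⦄,
    (rel e).r x y → (rel e').r (F.map h x) (F.map h y)

section AutTopology

variable {C : Type v} [SmallCategory C]

/-- Some object of `C` maps to a given ind-object. -/
theorem exists_hom (u : Ind C) : ∃ c : C, Nonempty (Ind.yoneda.obj c ⟶ u) := by
  have : IsFiltered (CostructuredArrow (Ind.yoneda (C := C)) u) :=
    RepresentablyCoflat.filtered u
  obtain ⟨X⟩ := (IsFiltered.nonempty : Nonempty (CostructuredArrow (Ind.yoneda (C := C)) u))
  exact ⟨X.left, ⟨X.hom⟩⟩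

/-- Two arrows from objects of `C` to an ind-object factor through a common one. -/
theorem exists_common_factor (u : Ind C) {c d : C} (χ : Ind.yoneda.obj c ⟶ u)
    (ψ : Ind.yoneda.obj d ⟶ u) :
    ∃ (e : C) (f : c ⟶ e) (g : d ⟶ e) (ω : Ind.yoneda.obj e ⟶ u),
      Ind.yoneda.map f ≫ ω = χ ∧ Ind.yoneda.map g ≫ ω = ψ := by
  have : IsFiltered (CostructuredArrow (Ind.yoneda (C := C)) u) :=
    RepresentablyCoflat.filtered u
  let X := CostructuredArrow.mk χ
  let Y := CostructuredArrow.mk ψ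
  exact ⟨(IsFiltered.max X Y).left, (IsFiltered.leftToMax X Y).left,
    (IsFiltered.rightToMax X Y).left, (IsFiltered.max X Y).hom,
    CostructuredArrow.w (IsFiltered.leftToMax X Y),
    CostructuredArrow.w (IsFiltered.rightToMax X Y)⟩

/-- The collection of the subgroups `I_χ`, for the arrows `χ : c ⟶ u` from objects `c` of `C` to
the ind-object `u`, as a base of neighbourhoods of the identity for a group topology. -/
@[reducible] def stabBasis (u : Ind C) : GroupFilterBasis (Aut u) where
  sets := {S | ∃ (c : C) (χ : Ind.yoneda.obj c ⟶ u), S = (stab χ : Set (Aut u))}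
  nonempty := by
    obtain ⟨c, ⟨χ⟩⟩ := exists_hom u
    exact ⟨_, c, χ, rfl⟩
  inter_sets := by
    rintro _ _ ⟨c, χ, rfl⟩ ⟨d, ψ, rfl⟩
    obtain ⟨e, f, g, ω, rfl, rfl⟩ := exists_common_factor u χ ψ
    refine ⟨_, ⟨e, ω, rfl⟩, fun z (hz : ω ≫ z.hom = ω) => ⟨?_, ?_⟩⟩
    · change (Ind.yoneda.map f ≫ ω) ≫ z.hom = Ind.yoneda.map f ≫ ω
      rw [Category.assoc, hz]
    · change (Ind.yoneda.map g ≫ ω) ≫ z.hom = Ind.yoneda.map g ≫ ω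
      rw [Category.assoc, hz]
  one' := by
    rintro _ ⟨c, χ, rfl⟩
    exact (stab χ).one_mem
  mul' := by
    rintro _ ⟨c, χ, rfl⟩
    refine ⟨_, ⟨c, χ, rfl⟩, ?_⟩
    rintro _ ⟨a, ha, b, hb, rfl⟩
    exact (stab χ).mul_mem ha hb
  inv' := by
    rintro _ ⟨c, χ, rfl⟩
    exact ⟨_, ⟨c, χ, rfl⟩, fun a ha => (stab χ).inv_mem ha⟩
  conj' := by
    rintro a _ ⟨c, χ, rfl⟩
    refine ⟨_, ⟨c, χ ≫ a.inv, rfl⟩, fun z (hz : (χ ≫ a.inv) ≫ z.hom = χ ≫ a.inv) => ?_⟩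
    let i : u ≅ u := a
    let k : u ≅ u := z
    have hk : (χ ≫ i.inv) ≫ k.hom = χ ≫ i.inv := hz
    change χ ≫ i.inv ≫ k.hom ≫ i.hom = χ
    rw [← Category.assoc, ← Category.assoc, hk, Category.assoc, Iso.inv_hom_id, Category.comp_id]

/-- The topology of the group of automorphisms of an ind-object `u` of `C`: the group topology in
which the subgroups `I_χ`, for the arrows `χ : c ⟶ u` with `c` in `C`, form a base of
neighbourhoods of the identity. -/
noncomputable instance autTopology (u : Ind C) : TopologicalSpace (Aut u) :=
  (stabBasis u).topology

/-- The set of the automorphisms `z` of `u` such that `ξ = χ ∘ f` and `z ∘ ξ = χ ∘ g` for some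
`(f, g)` in `R`, with common codomain `e`, and some `χ : e ⟶ u`. -/
def relSet {u : Ind C} {c : C} (ξ : Ind.yoneda.obj c ⟶ u)
    (R : FunctorEquivRel (coyoneda.obj (op c))) : Set (Aut u) :=
  {z | ∃ (e : C) (f g : c ⟶ e) (χ : Ind.yoneda.obj e ⟶ u), (R.rel e).r f g ∧
    ξ = Ind.yoneda.map f ≫ χ ∧ ξ ≫ z.hom = Ind.yoneda.map g ≫ χ}

end AutTopology

end IndGalois

namespace IndGalois

section

variable {C : Type v} [SmallCategory C] {u : Ind C}

/-! By ultrahomogeneity `Aut u` acts transitively on the arrows `c ⟶ u`, so these form the coset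
space of `stab ξ`. A subgroup `H` containing `stab ξ` thus amounts to an invariant equivalence
relation on them: `a ∘ ξ` and `b ∘ ξ` are related when `a⁻¹ * b ∈ H`. Pulling it back along arrows
`χ : e ⟶ u` gives `subgroupRel`, and `relSet_subgroupRel` recovers `H`. Conversely, filteredness of
the category of arrows from `C` to `u` makes each `relSet ξ R` a subgroup (`relSubgroup`). Openness
is automatic for subgroups containing `stab ξ`, and every open subgroup contains some `stab ξ`. -/

theorem aut_mul_comp {x : Ind C} (χ : x ⟶ u) (a b : Aut u) :
    χ ≫ (a * b).hom = (χ ≫ b.hom) ≫ a.hom :=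
  (Category.assoc χ b.hom a.hom).symm

theorem aut_one_comp {x : Ind C} (χ : x ⟶ u) : χ ≫ (1 : Aut u).hom = χ :=
  Category.comp_id χ

theorem aut_comp_inv_comp {x : Ind C} (χ : x ⟶ u) (a : Aut u) :
    (χ ≫ a.hom) ≫ (a⁻¹).hom = χ := by
  rw [← aut_mul_comp, inv_mul_cancel, aut_one_comp]

theorem inv_mul_mem_stab {x : Ind C} {χ : x ⟶ u} {a b : Aut u}
    (h : χ ≫ a.hom = χ ≫ b.hom) : a⁻¹ * b ∈ stab χ := by
  change χ ≫ (a⁻¹ * b).hom = χ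
  rw [aut_mul_comp, ← h, aut_comp_inv_comp]

/-- Parallel arrows of `C` identified by an arrow to an ind-object are already identified in `C`
at a later stage. -/
theorem exists_coequalizing_factor {c d : C} (f g : c ⟶ d) (χ : Ind.yoneda.obj d ⟶ u)
    (h : Ind.yoneda.map f ≫ χ = Ind.yoneda.map g ≫ χ) :
    ∃ (e : C) (l : d ⟶ e) (ω : Ind.yoneda.obj e ⟶ u),
      f ≫ l = g ≫ l ∧ Ind.yoneda.map l ≫ ω = χ := by
  have : IsFiltered (CostructuredArrow (Ind.yoneda (C := C)) u) :=
    RepresentablyCoflat.filtered u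
  let X : CostructuredArrow (Ind.yoneda (C := C)) u :=
    CostructuredArrow.mk (Ind.yoneda.map f ≫ χ)
  let Y : CostructuredArrow (Ind.yoneda (C := C)) u := CostructuredArrow.mk χ
  let F : X ⟶ Y := CostructuredArrow.homMk f rfl
  let G : X ⟶ Y := CostructuredArrow.homMk g h.symm
  exact ⟨(IsFiltered.coeq F G).left, (IsFiltered.coeqHom F G).left, (IsFiltered.coeq F G).hom,
    congrArg CommaMorphism.left (IsFiltered.coeq_condition F G),
    CostructuredArrow.w (IsFiltered.coeqHom F G)⟩

/-- The set `relSet ξ R` as a subgroup of the automorphism group. -/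
def relSubgroup {c : C} (ξ : Ind.yoneda.obj c ⟶ u)
    (R : FunctorEquivRel (coyoneda.obj (op c))) : Subgroup (Aut u) where
  carrier := relSet ξ R
  one_mem' := ⟨c, 𝟙 c, 𝟙 c, ξ, (R.rel c).refl _, by simp, by
    rw [aut_one_comp]; simp⟩
  inv_mem' := by
    rintro z ⟨e, f, g, χ, hR, hf, hg⟩
    refine ⟨e, g, f, χ ≫ (z⁻¹).hom, (R.rel e).symm hR, ?_, ?_⟩
    · rw [← Category.assoc, ← hg, aut_comp_inv_comp]
    · rw [← Category.assoc, ← hf]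
  mul_mem' := by
    rintro z w ⟨e, f, g, χ, hR, hf, hg⟩ ⟨e', f', g', χ', hR', hf', hg'⟩
    -- Transporting the witness of `w` by `z` makes the two witnesses meet at `z ∘ ξ`, which is both
    -- `χ ∘ g` and `z ∘ χ' ∘ f'`.
    obtain ⟨d, h, k, ω, hh, hk⟩ := exists_common_factor u χ (χ' ≫ z.hom)
    have hmid : Ind.yoneda.map (g ≫ h) ≫ ω = Ind.yoneda.map (f' ≫ k) ≫ ω := by
      rw [Functor.map_comp, Functor.map_comp, Category.assoc, Category.assoc, hh, hk, ← hg,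
        ← Category.assoc, ← hf']
    -- Transitivity of `R` needs the middle arrows equal in `C`, not merely after composition with
    -- `ω`.
    obtain ⟨d', l, ω', hl, hω⟩ := exists_coequalizing_factor _ _ ω hmid
    have h₁ : (R.rel d').r (f ≫ h ≫ l) (g ≫ h ≫ l) := R.map_rel (h ≫ l) hR
    have h₂ : (R.rel d').r (f' ≫ k ≫ l) (g' ≫ k ≫ l) := R.map_rel (k ≫ l) hR'
    have h₃ : g ≫ h ≫ l = f' ≫ k ≫ l := by simpa only [Category.assoc] using hl
    refine ⟨d', f ≫ h ≫ l, g' ≫ k ≫ l, ω', (R.rel d').trans h₁ (h₃ ▸ h₂), ?_, ?_⟩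
    · simp only [Functor.map_comp, Category.assoc, hω, hh, hf]
    · rw [aut_mul_comp, hg']
      simp only [Functor.map_comp, Category.assoc, hω, hk]

theorem stab_le_relSubgroup {c : C} (ξ : Ind.yoneda.obj c ⟶ u)
    (R : FunctorEquivRel (coyoneda.obj (op c))) : stab ξ ≤ relSubgroup ξ R :=
  fun z (hz : ξ ≫ z.hom = ξ) =>
    ⟨c, 𝟙 c, 𝟙 c, ξ, (R.rel c).refl _, by simp, by rw [hz]; simp⟩

theorem mem_nhds_one_iff {U : Set (Aut u)} :
    U ∈ nhds (1 : Aut u) ↔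
      ∃ (c : C) (χ : Ind.yoneda.obj c ⟶ u), (stab χ : Set (Aut u)) ⊆ U := by
  rw [(stabBasis u).nhds_one_hasBasis.mem_iff]
  constructor
  · rintro ⟨_, ⟨c, χ, rfl⟩, h⟩
    exact ⟨c, χ, h⟩
  · rintro ⟨c, χ, h⟩
    exact ⟨_, ⟨c, χ, rfl⟩, h⟩

/-- A subgroup containing some `stab ξ` is open. -/
theorem isOpen_of_stab_le {c : C} {ξ : Ind.yoneda.obj c ⟶ u} {H : Subgroup (Aut u)}
    (h : stab ξ ≤ H) : IsOpen (H : Set (Aut u)) := by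
  have : IsTopologicalGroup (Aut u) := (stabBasis u).isTopologicalGroup
  exact H.isOpen_of_mem_nhds (g := 1) (mem_nhds_one_iff.2 ⟨c, ξ, h⟩)

/-- The equivalence relation on `C(c, -)` induced by a subgroup containing `stab ξ`. -/
def subgroupRel (hultra : IsUltrahomogeneous (Ind.yoneda (C := C)) u) {c : C}
    (ξ : Ind.yoneda.obj c ⟶ u) (H : Subgroup (Aut u)) (hH : stab ξ ≤ H) :
    FunctorEquivRel (coyoneda.obj (op c)) where
  rel e :=
    -- Quantifying over every `χ` makes stability under `h : e ⟶ e'` immediate: test at `χ ∘ h`.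
    { r := fun (f g : c ⟶ e) => ∀ (χ : Ind.yoneda.obj e ⟶ u) (a b : Aut u),
        ξ ≫ a.hom = Ind.yoneda.map f ≫ χ → ξ ≫ b.hom = Ind.yoneda.map g ≫ χ → a⁻¹ * b ∈ H
      iseqv :=
        { refl := fun f χ a b ha hb => hH (inv_mul_mem_stab (ha.trans hb.symm))
          symm := fun h χ a b ha hb => by
            simpa using H.inv_mem (h χ b a hb ha)
          trans := by
            intro f g k h₁ h₂ χ a b ha hb
            -- Ultrahomogeneity lifts the middle arrow `χ ∘ g` to an automorphism, so that `a⁻¹ * b`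
            -- splits as `(a⁻¹ * t) * (t⁻¹ * b)`.
            obtain ⟨t, ht⟩ := hultra g ξ χ
            let t' : Aut u := t
            simpa [mul_assoc] using H.mul_mem (h₁ χ a t' ha ht) (h₂ χ t' b ht hb) } }
  map_rel := by
    intro e e' h f g hfg χ a b ha hb
    refine hfg (Ind.yoneda.map h ≫ χ) a b (ha.trans ?_) (hb.trans ?_)
    · exact (congrArg (· ≫ χ) (Ind.yoneda.map_comp f h)).trans (Category.assoc _ _ _)
    · exact (congrArg (· ≫ χ) (Ind.yoneda.map_comp g h)).trans (Category.assoc _ _ _)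

/-- A pair related in `subgroupRel` can be tested at its own `χ` with the lifts `1` and `z`.
Conversely, for `z ∈ H`, a common factorization of `ξ` and `z ∘ ξ` gives a pair satisfying the test
at one `χ`, and ultrahomogeneity carries it to every other. -/
theorem relSet_subgroupRel (hultra : IsUltrahomogeneous (Ind.yoneda (C := C)) u) {c : C}
    (ξ : Ind.yoneda.obj c ⟶ u) (H : Subgroup (Aut u)) (hH : stab ξ ≤ H) :
    relSet ξ (subgroupRel hultra ξ H hH) = (H : Set (Aut u)) := by
  ext z
  constructor
  · rintro ⟨e, f, g, χ, hR, hf, hg⟩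
    have := hR χ 1 z ((aut_one_comp ξ).trans hf) hg
    simpa using this
  · intro hz
    obtain ⟨e, f, g, χ, hf, hg⟩ := exists_common_factor u ξ (ξ ≫ z.hom)
    refine ⟨e, f, g, χ, ?_, hf.symm, hg.symm⟩
    intro χ' a b ha hb
    -- As `t` carries `χ` to `χ'`, on `ξ` the automorphism `a` agrees with `t`, and `b` with `t *
    -- z`. Hence `a⁻¹ * b` is `z` multiplied on both sides by elements of `stab ξ`.
    obtain ⟨t, ht⟩ := hultra (𝟙 e) χ χ'
    let t' : Aut u := t
    replace ht : χ ≫ t'.hom = χ' := by simpa using ht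
    have h₁ : a⁻¹ * t' ∈ H := hH (inv_mul_mem_stab (by
      rw [ha, ← ht, ← Category.assoc, hf]))
    have h₂ : (t' * z)⁻¹ * b ∈ H := hH (inv_mul_mem_stab (by
      rw [hb, ← ht, ← Category.assoc, hg, aut_mul_comp]))
    have := H.mul_mem (H.mul_mem h₁ hz) h₂
    simpa [mul_assoc] using this

theorem isOpenSubgroup_iff_eq_relSet (hultra : IsUltrahomogeneous (Ind.yoneda (C := C)) u) {c : C}
    (ξ : Ind.yoneda.obj c ⟶ u) (U : Set (Aut u)) (hU : (stab ξ : Set (Aut u)) ⊆ U) :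
    (∃ H : OpenSubgroup (Aut u), (H : Set (Aut u)) = U) ↔
      ∃ R : FunctorEquivRel (coyoneda.obj (op c)), U = relSet ξ R := by
  constructor
  · rintro ⟨H, rfl⟩
    exact ⟨_, (relSet_subgroupRel hultra ξ H.toSubgroup hU).symm⟩
  · rintro ⟨R, rfl⟩
    exact ⟨⟨relSubgroup ξ R, isOpen_of_stab_le (stab_le_relSubgroup ξ R)⟩, rfl⟩

end

end IndGalois

theorem theorem4p10 {C : Type v} [SmallCategory C] [Nonempty C]
    (hAP : IndGalois.AmalgamationProperty C) (hJEP : IndGalois.JointEmbeddingProperty C)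
    (u : Ind C) (huniv : IndGalois.IsUniversal (Ind.yoneda (C := C)) u)
    (hultra : IndGalois.IsUltrahomogeneous (Ind.yoneda (C := C)) u) :
    (∀ U : Set (Aut u),
      (∃ H : OpenSubgroup (Aut u), (H : Set (Aut u)) = U) ↔
        ∃ (c : C) (ξ : Ind.yoneda.obj c ⟶ u)
          (R : IndGalois.FunctorEquivRel (coyoneda.obj (op c))),
          U = IndGalois.relSet ξ R) ∧
    (∀ (c : C) (ξ : Ind.yoneda.obj c ⟶ u) (U : Set (Aut u)),
      (IndGalois.stab ξ : Set (Aut u)) ⊆ U →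
      ((∃ H : OpenSubgroup (Aut u), (H : Set (Aut u)) = U) ↔
        ∃ R : IndGalois.FunctorEquivRel (coyoneda.obj (op c)),
          U = IndGalois.relSet ξ R)) := by
  refine ⟨fun U => ⟨?_, ?_⟩, fun c ξ U hU => IndGalois.isOpenSubgroup_iff_eq_relSet hultra ξ U hU⟩
  · rintro ⟨H, rfl⟩
    obtain ⟨c, ξ, h⟩ := IndGalois.mem_nhds_one_iff.1 H.mem_nhds_one
    exact ⟨c, ξ, (IndGalois.isOpenSubgroup_iff_eq_relSet hultra ξ _ h).1 ⟨H, rfl⟩⟩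
  · rintro ⟨c, ξ, R, rfl⟩
    exact (IndGalois.isOpenSubgroup_iff_eq_relSet hultra ξ _
      (IndGalois.stab_le_relSubgroup ξ R)).2 ⟨R, rfl⟩
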